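/- Let $\mathbb X\subset\mathbb R^d$ be a Borel set (state space) and $\mathbb U\subset\mathbb R^m$ a compact set (action space). Let $c:\mathbb X\times\mathbb U\to\mathbb R$ be a bounded Borel measurable cost such that $u\mapsto c(x,u)$ is continuous for every $x$. For a stochastic kernel $\mathcal T(dy|x,u)$ from $\mathbb X\times\mathbb U$ to $\mathbb X$, an initial state $x_0$ and an admissible policy $\gamma=(\gamma_t)_{t\ge0}$ (that is, $U_t=\gamma_t(X_0,\dots,X_t,U_0,\dots,U_{t-1})$ with $\gamma_t$ measurable), put $$J_\infty(\mathcal T,\gamma)=\limsup_{N\to\infty}\frac1N\,E^{\mathcal T,\gamma}_{x_0}\Big[\sum_{t=0}^{N-1}c(X_t,U_t)\Big],\qquad J^*_\infty(\mathcal T)=\inf_{\gamma\text{ admissible}}J_\infty(\mathcal T,\gamma).$$ A stationary policy is a measurable map $\gamma:\mathbb X\to\mathbb U$, used as $U_t=\gamma(X_t)$. Write $\Gamma_s$ for the set of stationary policies and $\mathcal T^t(\cdot|x,\gamma)$ for the $t$-step kernel of the chain with one-step kernel $\mathcal T(\cdot|x,\gamma(x))$. Let $\|\mu-\nu\|_{TV}=\sup\{|\int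 f\,d\mu-\int f\,d\nu|: f \text{ measurable},\ |f|\le1\}$. Let $\mathcal T$ and $\mathcal T_n$ ($n\in\mathbb N$) be stochastic kernels from $\mathbb X\times\mathbb U$ to $\mathbb X$ such that: 1. **(Uniform ergodicity)** At least one of the following holds for all kernels $\mathcal S\in\{\mathcal T,\mathcal T_1,\mathcal T_2,\dots\}$, with the numbers $t,\beta,\delta,\varepsilon,M,C$ and the rate in (i) the same for all these kernels, while $z,\mu,m,D,p_0$ may depend on $\mathcal S$ (but not on $x$ or $\gamma$), and $p,\mu_\gamma,\pi_\gamma$ may depend on $\mathcal S$ and $\gamma$. All inequalities are for all $x,x'\in\mathbb X$ and $\gamma\in\Gamma_s$. - (a) $\mathcal S(\{z\}|x,\gamma)\ge\beta$ for some state $z$, where $\beta>0$. - (b) $\mathcal S^t(\cdot|x,\gamma)\ge\mu$ for a measure $\mu$ with $\mu(\mathbb X)\ge\delta>0$, where $t\ge1$. - (c) $\mathcal S(\cdot|x,\gamma)$ has a density $p(\cdot|x,\gamma)$ with respect to a $\sigma$-finite measure $m$, with $p(y|x,\gamma)\ge\varepsilon>0$ for $y$ in a Borel set $D$ with $m(D)\ge\delta>0$.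 - (d) $\mathcal S(\cdot|x,\gamma)$ has a density $p(\cdot|x,\gamma)$ with respect to a $\sigma$-finite measure $m$, with $p(\cdot|x,\gamma)\ge p_0$ for a measurable $p_0\ge0$ with $\int p_0\,dm\ge\delta>0$. - (e) $\mathcal S^t(\cdot|x,\gamma)\le\mu$ for a measure $\mu$ with $\mu(\mathbb X)\le M<2$, where $t\ge1$. - (f) $\|\mathcal S^t(\cdot|x,\gamma)-\mathcal S^t(\cdot|x',\gamma)\|_{TV}\le2\beta$, where $t\ge1$ and $0<\beta<1$. - (g) $\mathcal S^t(\cdot|x,\gamma)\ge\beta\mu_\gamma$ for a probability measure $\mu_\gamma$, where $t\ge1$ and $\beta>0$. - (h) $\|\mathcal S^t(\cdot|x,\gamma)-\pi_\gamma\|_{TV}\le C\beta^t$ for all $t\ge1$ and a probability measure $\pi_\gamma$, where $C>0$ and $0<\beta<1$. - (i) $\|\mathcal S^t(\cdot|x,\gamma)-\pi_\gamma\|_{TV}\to0$ as $t\to\infty$ for probability measures $\pi_\gamma$, uniformly in $x$, $\gamma$ and $\mathcal S$. 2. **(Continuity in the action)** For every $x$ and every bounded measurable $f:\mathbb X\to\mathbb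 R$, the map $u\mapsto\int f(y)\,\mathcal T(dy|x,u)$ is continuous. 3. **(Convergence)** For every $x$ and all $u_n\to u$ in $\mathbb U$, $\|\mathcal T_n(\cdot|x,u_n)-\mathcal T(\cdot|x,u)\|_{TV}\to0$. Let $x_0\in\mathbb X$ and, for each $n$, let $\gamma_n^*$ be any stationary policy that is optimal for $\mathcal T_n$ and the initial state $x_0$, in the sense that $J_\infty(\mathcal T_n,\gamma_n^*)\le J_\infty(\mathcal T_n,\gamma)$ for all $\gamma\in\Gamma_s$ (it need not solve the average cost optimality equation). Then $$|J_\infty(\mathcal T,\gamma_n^*)-J^*_\infty(\mathcal T)|\to0\qquad(n\to\infty).$$ -/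

import Mathlib

open MeasureTheory ProbabilityTheory Filter Topology
open scoped ENNReal

noncomputable section

namespace AvgCost

/-! ### Total variation -/

/-- The total variation distance, normalised so that it is at most `2` between probability
measures: the supremum of `|∫ f dμ - ∫ f dν|` over measurable `f` with `|f| ≤ 1`. -/
def tvDist {X : Type*} [MeasurableSpace X] (μ ν : Measure X) : ℝ :=
  ⨆ f : {f : X → ℝ // Measurable f ∧ ∀ x, |f x| ≤ 1}, |∫ x, f.1 x ∂μ - ∫ x, f.1 x ∂ν|

/-! ### Policies -/

/-- A (deterministic) admissible policy: the action at time `t` is a measurable function of the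
past states and actions `(X_s, U_s)`, `s < t`, and of the current state `X_t`. -/
structure Policy (X U : Type*) [MeasurableSpace X] [MeasurableSpace U] where
  act : (t : ℕ) → (Fin t → X × U) → X → U
  measurable_act : ∀ t, Measurable fun p : (Fin t → X × U) × X => act t p.1 p.2

/-- A (deterministic) stationary policy: a measurable map from states to actions. -/
structure StationaryPolicy (X U : Type*) [MeasurableSpace X] [MeasurableSpace U] where
  act : X → U
  measurable_act : Measurable act

variable {X U : Type*} [MeasurableSpace X] [MeasurableSpace U]

/-- A stationary policy, regarded as an admissible policy. -/
def StationaryPolicy.toPolicy (γ : StationaryPolicy X U) : Policy X U where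
  act := fun _ _ x => γ.act x
  measurable_act := fun _ => γ.measurable_act.comp measurable_snd

/-! ### The controlled process and its average cost -/

/-- The state-action pairs at the times `0, …, t`, indexed by `Fin (t + 1)`. -/
def histFin (t : ℕ) (h : (_i : Finset.Iic t) → X × U) : Fin (t + 1) → X × U :=
  fun i => h ⟨i.1, Finset.mem_Iic.2 (Nat.lt_succ_iff.1 i.2)⟩

/-- The last state-action pair of a history up to time `t`. -/
def histLast (t : ℕ) (h : (_i : Finset.Iic t) → X × U) : X × U :=
  h ⟨t, Finset.mem_Iic.2 le_rfl⟩

lemma measurable_histFin (t : ℕ) :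
    Measurable (histFin t : ((_i : Finset.Iic t) → X × U) → _) :=
  measurable_pi_lambda _ fun _ => measurable_pi_apply _

lemma measurable_histLast (t : ℕ) :
    Measurable (histLast t : ((_i : Finset.Iic t) → X × U) → _) :=
  measurable_pi_apply _

/-- The next state-action pair produced by a policy from the history `p.1` up to time `t` and the
new state `p.2`. -/
def nextPair (γ : Policy X U) (t : ℕ) (p : ((_i : Finset.Iic t) → X × U) × X) : X × U :=
  (p.2, γ.act (t + 1) (histFin t p.1) p.2)

lemma measurable_nextPair (γ : Policy X U) (t : ℕ) : Measurable (nextPair γ t) :=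
  measurable_snd.prodMk ((γ.measurable_act (t + 1)).comp
    (((measurable_histFin t).comp measurable_fst).prodMk measurable_snd))

/-- The conditional law of `(X_{t+1}, U_{t+1})` given the history up to time `t`: the state
`X_{t+1}` has law `T(· | X_t, U_t)`, and then `U_{t+1}` is chosen by the policy. -/
def stepKernel (T : Kernel (X × U) X) (γ : Policy X U) (t : ℕ) :
    Kernel ((_i : Finset.Iic t) → X × U) (X × U) :=
  (Kernel.id ×ₖ (T.comap (histLast t) (measurable_histLast t))).map (nextPair γ t)

instance (T : Kernel (X × U) X) [IsMarkovKernel T] (γ : Policy X U) (t : ℕ) :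
    IsMarkovKernel (stepKernel T γ t) :=
  Kernel.IsMarkovKernel.map _ (measurable_nextPair γ t)

/-- The law of the state-action process `(X_t, U_t)_{t ≥ 0}` started at `X_0 = x₀` under the
transition kernel `T` and the policy `γ`. -/
def processLaw (T : Kernel (X × U) X) [IsMarkovKernel T] (γ : Policy X U) (x₀ : X) :
    Measure (ℕ → X × U) :=
  Kernel.traj (X := fun _ => X × U) (stepKernel T γ) 0
    (fun _ => (x₀, γ.act 0 Fin.elim0 x₀))

/-- The infinite-horizon average expected cost
`limsup_N (1/N) E [∑_{t < N} c (X_t, U_t)]`. -/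
def avgCost (c : X × U → ℝ) (T : Kernel (X × U) X) [IsMarkovKernel T] (γ : Policy X U)
    (x₀ : X) : ℝ :=
  limsup (fun N : ℕ =>
    (1 / (N : ℝ)) * ∫ ω, (∑ t ∈ Finset.range N, c (ω t)) ∂(processLaw T γ x₀)) atTop

/-- The optimal average cost: the infimum over all admissible policies. -/
def optCost (c : X × U → ℝ) (T : Kernel (X × U) X) [IsMarkovKernel T] (x₀ : X) : ℝ :=
  ⨅ γ : Policy X U, avgCost c T γ x₀

/-- A stationary policy is optimal (for the initial state `x₀`) if no stationary policy has a
smaller average cost. In particular this holds if it attains the infimum over all admissible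
policies. -/
def IsOptimalStationary (c : X × U → ℝ) (T : Kernel (X × U) X) [IsMarkovKernel T] (x₀ : X)
    (γ : StationaryPolicy X U) : Prop :=
  ∀ γ' : StationaryPolicy X U, avgCost c T γ.toPolicy x₀ ≤ avgCost c T γ'.toPolicy x₀

/-! ### Uniform ergodicity conditions

The conditions are stated for a set `𝒮` of controlled transition kernels. In each of them the
numerical constants (times, rates, lower bounds for masses) serve all kernels of `𝒮` at once,
while points, sets, measures and densities may vary with the kernel. For a one-element set
`𝒮` this is the usual condition for a single controlled kernel. -/

/-- The one-step kernel `T(· | x, γ) = T(· | x, γ(x))`; its `t`-th power `closedLoop T γ ^ t` in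
the monoid of kernels (multiplication being composition) is the `t`-step kernel. -/
def closedLoop (T : Kernel (X × U) X) (γ : StationaryPolicy X U) : Kernel X X :=
  T.comap (fun x => (x, γ.act x)) (measurable_id.prodMk γ.measurable_act)

/-- (a) An atom that is reached in one step with probability bounded below. -/
def ErgAtom (𝒮 : Set (Kernel (X × U) X)) : Prop :=
  ∃ β : ℝ≥0∞, 0 < β ∧ ∀ T ∈ 𝒮, ∃ z : X, ∀ (x : X) (γ : StationaryPolicy X U),
    β ≤ closedLoop T γ x {z}

/-- (b) The `t`-step kernels dominate a common non-trivial measure. -/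
def ErgMinorant (𝒮 : Set (Kernel (X × U) X)) : Prop :=
  ∃ t : ℕ, 0 < t ∧ ∃ δ : ℝ≥0∞, 0 < δ ∧ ∀ T ∈ 𝒮, ∃ μ : Measure X, δ ≤ μ Set.univ ∧
    ∀ (x : X) (γ : StationaryPolicy X U), μ ≤ (closedLoop T γ ^ t) x

/-- (c) Densities bounded below by a constant on a set of positive measure. -/
def ErgDensityOn (𝒮 : Set (Kernel (X × U) X)) : Prop :=
  ∃ ε : ℝ≥0∞, 0 < ε ∧ ∃ δ : ℝ≥0∞, 0 < δ ∧ ∀ T ∈ 𝒮, ∃ m : Measure X, SigmaFinite m ∧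
    ∃ C : Set X, MeasurableSet C ∧ δ ≤ m C ∧ ∀ γ : StationaryPolicy X U, ∃ p : X → X → ℝ≥0∞,
      (∀ x, Measurable (p x) ∧ closedLoop T γ x = m.withDensity (p x)) ∧
      ∀ x, ∀ y ∈ C, ε ≤ p x y

/-- (d) Densities bounded below by a function of positive integral. -/
def ErgDensity (𝒮 : Set (Kernel (X × U) X)) : Prop :=
  ∃ δ : ℝ≥0∞, 0 < δ ∧ ∀ T ∈ 𝒮, ∃ m : Measure X, SigmaFinite m ∧
    ∃ p₀ : X → ℝ≥0∞, Measurable p₀ ∧ δ ≤ ∫⁻ y, p₀ y ∂m ∧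
    ∀ γ : StationaryPolicy X U, ∃ p : X → X → ℝ≥0∞,
      (∀ x, Measurable (p x) ∧ closedLoop T γ x = m.withDensity (p x)) ∧
      ∀ x y, p₀ y ≤ p x y

/-- (e) The `t`-step kernels are dominated by a common measure of mass less than `2`. -/
def ErgMajorant (𝒮 : Set (Kernel (X × U) X)) : Prop :=
  ∃ t : ℕ, 0 < t ∧ ∃ M : ℝ≥0∞, M < 2 ∧ ∀ T ∈ 𝒮, ∃ μ : Measure X, μ Set.univ ≤ M ∧
    ∀ (x : X) (γ : StationaryPolicy X U), (closedLoop T γ ^ t) x ≤ μ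

/-- (f) A `t`-step contraction in total variation. -/
def ErgContraction (𝒮 : Set (Kernel (X × U) X)) : Prop :=
  ∃ t : ℕ, 0 < t ∧ ∃ β : ℝ, 0 < β ∧ β < 1 ∧ ∀ T ∈ 𝒮,
    ∀ (x x' : X) (γ : StationaryPolicy X U),
      tvDist ((closedLoop T γ ^ t) x) ((closedLoop T γ ^ t) x') ≤ 2 * β

/-- (g) A `t`-step minorisation by policy-dependent probability measures. -/
def ErgDoeblin (𝒮 : Set (Kernel (X × U) X)) : Prop :=
  ∃ t : ℕ, 0 < t ∧ ∃ β : ℝ≥0∞, 0 < β ∧ ∀ T ∈ 𝒮, ∀ γ : StationaryPolicy X U,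
    ∃ μ : Measure X, IsProbabilityMeasure μ ∧ ∀ x : X, β • μ ≤ (closedLoop T γ ^ t) x

/-- (h) Uniform geometric ergodicity. -/
def ErgGeometric (𝒮 : Set (Kernel (X × U) X)) : Prop :=
  ∃ C β : ℝ, 0 < C ∧ 0 < β ∧ β < 1 ∧ ∀ T ∈ 𝒮, ∀ γ : StationaryPolicy X U,
    ∃ π : Measure X, IsProbabilityMeasure π ∧
      ∀ (x : X) (t : ℕ), 0 < t → tvDist ((closedLoop T γ ^ t) x) π ≤ C * β ^ t

/-- (i) Uniform ergodicity: convergence of the `t`-step kernels in total variation, uniformly in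
the initial state, the stationary policy and the kernel. -/
def ErgUniform (𝒮 : Set (Kernel (X × U) X)) : Prop :=
  ∃ π : Kernel (X × U) X → StationaryPolicy X U → Measure X,
    (∀ T ∈ 𝒮, ∀ γ, IsProbabilityMeasure (π T γ)) ∧
    ∀ ε : ℝ, 0 < ε → ∃ t₀ : ℕ, ∀ t ≥ t₀, ∀ T ∈ 𝒮, ∀ (γ : StationaryPolicy X U) (x : X),
      tvDist ((closedLoop T γ ^ t) x) (π T γ) ≤ ε

/-- At least one of the ergodicity conditions (a)-(i) holds uniformly over `𝒮`. -/
def UniformlyErgodic (𝒮 : Set (Kernel (X × U) X)) : Prop :=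
  ErgAtom 𝒮 ∨ ErgMinorant 𝒮 ∨ ErgDensityOn 𝒮 ∨ ErgDensity 𝒮 ∨ ErgMajorant 𝒮 ∨
    ErgContraction 𝒮 ∨ ErgDoeblin 𝒮 ∨ ErgGeometric 𝒮 ∨ ErgUniform 𝒮

/-- Setwise continuity of a controlled transition kernel in the action, for every state. -/
def SetwiseContinuousInAction [TopologicalSpace U] (T : Kernel (X × U) X) : Prop :=
  ∀ (x : X) (f : X → ℝ), Measurable f → (∃ M : ℝ, ∀ y, |f y| ≤ M) →
    Continuous fun u : U => ∫ y, f y ∂(T (x, u))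

end AvgCost

end

/-!
Each of the ergodicity conditions forces the `t`-step kernels of all closed loops to contract total
variation by a common factor `β < 1`. Hence the expected cost at time `k` approximates the average
cost of a stationary policy at the geometric rate `β ^ (k / t)`, uniformly in the policy and in the
kernel. The expected cost at a fixed time is continuous along `Tₙ → T`, uniformly in the policy
because the action space is compact. Therefore `J(Tₙ, γₙ) - J(T, γₙ) → 0` for every sequence of
stationary policies.

The contraction also bounds the oscillation of the value functions of `T` independently of the
discount factor. Letting the discount vanish solves the average cost optimality equation of `T` up
to any `ε > 0`, so that some stationary policy `σ` is `ε`-optimal among all admissible policies.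
Then `J(T, γₙ*) ≈ J(Tₙ, γₙ*) ≤ J(Tₙ, σ) ≈ J(T, σ) ≤ J*(T) + ε`. No optimality equation for `Tₙ`
enters.
-/

namespace AvgCost

/-! ### Bounded measurable functions -/

section BddMeasurable

variable {X Y : Type*} [MeasurableSpace X] [MeasurableSpace Y]

/-- A bounded measurable real function. These are the costs and the value functions below: the
functions that every probability measure integrates. -/
structure IsBddMeasurable (f : X → ℝ) : Prop where
  measurable : Measurable f
  exists_bound : ∃ M : ℝ, ∀ x, |f x| ≤ M

namespace IsBddMeasurable

variable {f g : X → ℝ}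

lemma integrable (hf : IsBddMeasurable f) (μ : Measure X) [IsFiniteMeasure μ] :
    Integrable f μ :=
  let ⟨M, hM⟩ := hf.exists_bound
  Integrable.of_bound hf.measurable.aestronglyMeasurable M (ae_of_all _ hM)

lemma comp (hf : IsBddMeasurable f) {φ : Y → X} (hφ : Measurable φ) :
    IsBddMeasurable fun y => f (φ y) :=
  ⟨hf.measurable.comp hφ, hf.exists_bound.imp fun _ hM y => hM (φ y)⟩

lemma add (hf : IsBddMeasurable f) (hg : IsBddMeasurable g) :
    IsBddMeasurable fun x => f x + g x :=
  let ⟨M, hM⟩ := hf.exists_bound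
  let ⟨N, hN⟩ := hg.exists_bound
  ⟨hf.measurable.add hg.measurable, M + N, fun x =>
    (abs_add_le _ _).trans (add_le_add (hM x) (hN x))⟩

lemma const_mul (hf : IsBddMeasurable f) (a : ℝ) : IsBddMeasurable fun x => a * f x :=
  let ⟨M, hM⟩ := hf.exists_bound
  ⟨hf.measurable.const_mul a, |a| * M, fun x => by rw [abs_mul]; gcongr; exact hM x⟩

end IsBddMeasurable

lemma abs_integral_le_of_abs_le {μ : Measure X} [IsProbabilityMeasure μ] {f : X → ℝ} {M : ℝ}
    (hM : ∀ x, |f x| ≤ M) : |∫ x, f x ∂μ| ≤ M := by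
  simpa using norm_integral_le_of_norm_le_const (μ := μ) (f := f) (ae_of_all _ hM)

lemma IsBddMeasurable.integral_kernel {f : X → ℝ} (hf : IsBddMeasurable f) (P : Kernel Y X)
    [IsMarkovKernel P] : IsBddMeasurable fun y => ∫ x, f x ∂P y :=
  ⟨hf.measurable.stronglyMeasurable.integral_kernel.measurable,
    hf.exists_bound.imp fun _ hM _ => abs_integral_le_of_abs_le hM⟩

end BddMeasurable

/-! ### Total variation -/

section TotalVariation

variable {X : Type*} [MeasurableSpace X] {μ ν : Measure X}

lemma abs_integral_sub_le_tvDist [IsProbabilityMeasure μ] [IsProbabilityMeasure ν] {f : X → ℝ}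
    (hf : Measurable f) (hf1 : ∀ x, |f x| ≤ 1) :
    |∫ x, f x ∂μ - ∫ x, f x ∂ν| ≤ tvDist μ ν := by
  refine le_ciSup (f := fun f : {f : X → ℝ // Measurable f ∧ ∀ x, |f x| ≤ 1} =>
    |∫ x, f.1 x ∂μ - ∫ x, f.1 x ∂ν|) ⟨1 + 1, ?_⟩ ⟨f, hf, hf1⟩
  rintro _ ⟨g, rfl⟩
  exact (abs_sub _ _).trans (add_le_add (abs_integral_le_of_abs_le g.2.2)
    (abs_integral_le_of_abs_le g.2.2))

lemma tvDist_le {a : ℝ} (h : ∀ f : X → ℝ, Measurable f → (∀ x, |f x| ≤ 1) →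
    |∫ x, f x ∂μ - ∫ x, f x ∂ν| ≤ a) : tvDist μ ν ≤ a :=
  have : Nonempty {f : X → ℝ // Measurable f ∧ ∀ x, |f x| ≤ 1} :=
    ⟨⟨fun _ => 0, measurable_const, by simp⟩⟩
  ciSup_le fun f => h f.1 f.2.1 f.2.2

lemma tvDist_nonneg (μ ν : Measure X) : 0 ≤ tvDist μ ν :=
  Real.iSup_nonneg fun _ => abs_nonneg _

lemma tvDist_comm (μ ν : Measure X) : tvDist μ ν = tvDist ν μ := by
  simp only [tvDist, abs_sub_comm]

lemma tvDist_triangle (μ ν ρ : Measure X) [IsProbabilityMeasure μ] [IsProbabilityMeasure ν]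
    [IsProbabilityMeasure ρ] : tvDist μ ρ ≤ tvDist μ ν + tvDist ν ρ :=
  tvDist_le fun _ hf hf1 => (abs_sub_le _ _ _).trans
    (add_le_add (abs_integral_sub_le_tvDist hf hf1) (abs_integral_sub_le_tvDist hf hf1))

lemma abs_integral_sub_le_mul_tvDist [IsProbabilityMeasure μ] [IsProbabilityMeasure ν]
    {f : X → ℝ} (hf : Measurable f) {M : ℝ} (hM : ∀ x, |f x| ≤ M) :
    |∫ x, f x ∂μ - ∫ x, f x ∂ν| ≤ M * tvDist μ ν := by
  obtain ⟨x⟩ := nonempty_of_isProbabilityMeasure μ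
  rcases ((abs_nonneg _).trans (hM x)).eq_or_lt with rfl | hM0
  · simp [funext fun x => abs_nonpos_iff.1 (hM x)]
  · have h := abs_integral_sub_le_tvDist (μ := μ) (ν := ν) (hf.const_mul M⁻¹) fun x => by
      rw [abs_mul, abs_of_pos (inv_pos.2 hM0), inv_mul_le_iff₀ hM0, mul_one]
      exact hM x
    rwa [integral_const_mul, integral_const_mul, ← mul_sub, abs_mul, abs_of_pos (inv_pos.2 hM0),
      inv_mul_le_iff₀ hM0] at h

lemma exists_forall_abs_sub_le_half {α : Type*} [Nonempty α] {f : α → ℝ} {R : ℝ}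
    (hR : ∀ x y, |f x - f y| ≤ R) : ∃ a, ∀ x, |f x - a| ≤ R / 2 := by
  have hbdd : BddBelow (Set.range f) := by
    inhabit α
    exact ⟨f default - R, Set.forall_mem_range.2 fun x => by
      linarith [(abs_le.1 (hR default x)).2]⟩
  refine ⟨(⨅ x, f x) + R / 2, fun x => abs_le.2 ⟨?_, ?_⟩⟩
  · linarith [ciInf_le hbdd x]
  · have : f x - R ≤ ⨅ y, f y := le_ciInf fun y => by linarith [(abs_le.1 (hR x y)).2]
    linarith

lemma abs_integral_sub_le_half_mul_tvDist [IsProbabilityMeasure μ] [IsProbabilityMeasure ν]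
    {f : X → ℝ} (hf : IsBddMeasurable f) {R : ℝ} (hR : ∀ x y, |f x - f y| ≤ R) :
    |∫ x, f x ∂μ - ∫ x, f x ∂ν| ≤ R / 2 * tvDist μ ν := by
  have := nonempty_of_isProbabilityMeasure μ
  obtain ⟨a, ha⟩ := exists_forall_abs_sub_le_half hR
  have h := abs_integral_sub_le_mul_tvDist (μ := μ) (ν := ν) (hf.measurable.sub_const a) ha
  rw [integral_sub (hf.integrable μ) (integrable_const a),
    integral_sub (hf.integrable ν) (integrable_const a)] at h
  simpa using h

lemma tvDist_le_of_add_eq_add [IsFiniteMeasure μ] [IsFiniteMeasure ν] {ρ σ : Measure X}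
    [IsFiniteMeasure ρ] [IsFiniteMeasure σ] (h : μ + ρ = ν + σ) :
    tvDist μ ν ≤ ρ.real Set.univ + σ.real Set.univ := by
  refine tvDist_le fun f hf hf1 => ?_
  have hfi (τ : Measure X) [IsFiniteMeasure τ] : Integrable f τ :=
    IsBddMeasurable.integrable ⟨hf, 1, hf1⟩ τ
  have hle (τ : Measure X) [IsFiniteMeasure τ] : |∫ x, f x ∂τ| ≤ τ.real Set.univ := by
    simpa using norm_integral_le_of_norm_le_const (μ := τ) (f := f) (ae_of_all _ hf1)
  have hadd : ∫ x, f x ∂μ + ∫ x, f x ∂ρ = ∫ x, f x ∂ν + ∫ x, f x ∂σ := by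
    rw [← integral_add_measure (hfi μ) (hfi ρ), ← integral_add_measure (hfi ν) (hfi σ), h]
  calc |∫ x, f x ∂μ - ∫ x, f x ∂ν|
      = |∫ x, f x ∂σ - ∫ x, f x ∂ρ| := congrArg _ (by linarith)
    _ ≤ |∫ x, f x ∂σ| + |∫ x, f x ∂ρ| := abs_sub _ _
    _ ≤ ρ.real Set.univ + σ.real Set.univ := by linarith [hle ρ, hle σ]

lemma measureReal_sub_univ [IsFiniteMeasure μ] (h : ν ≤ μ) :
    (μ - ν).real Set.univ = μ.real Set.univ - ν.real Set.univ := by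
  have := isFiniteMeasure_of_le μ h
  rw [eq_sub_iff_add_eq, ← measureReal_add_apply, Measure.sub_add_cancel_of_le h]

lemma tvDist_le_of_minorant {ρ : Measure X} [IsProbabilityMeasure μ] [IsProbabilityMeasure ν]
    (hμ : ρ ≤ μ) (hν : ρ ≤ ν) : tvDist μ ν ≤ 2 * (1 - ρ.real Set.univ) := by
  have := isFiniteMeasure_of_le μ hμ
  have hsum : μ + (ν - ρ) = ν + (μ - ρ) := by
    nth_rw 1 [← Measure.sub_add_cancel_of_le hμ]
    nth_rw 2 [← Measure.sub_add_cancel_of_le hν]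
    ac_rfl
  have h := tvDist_le_of_add_eq_add hsum
  rw [measureReal_sub_univ hμ, measureReal_sub_univ hν, probReal_univ (μ := μ),
    probReal_univ (μ := ν)] at h
  linarith

lemma tvDist_le_of_majorant {ρ : Measure X} [IsFiniteMeasure ρ] [IsProbabilityMeasure μ]
    [IsProbabilityMeasure ν] (hμ : μ ≤ ρ) (hν : ν ≤ ρ) :
    tvDist μ ν ≤ 2 * (ρ.real Set.univ - 1) := by
  have hsum : μ + (ρ - μ) = ν + (ρ - ν) := by
    rw [add_comm, Measure.sub_add_cancel_of_le hμ, add_comm, Measure.sub_add_cancel_of_le hν]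
  have h := tvDist_le_of_add_eq_add hsum
  rw [measureReal_sub_univ hμ, measureReal_sub_univ hν, probReal_univ (μ := μ),
    probReal_univ (μ := ν)] at h
  linarith

end TotalVariation

/-! ### Markov kernels and their contraction in total variation -/

section Contraction

variable {X : Type*} [MeasurableSpace X] {P : Kernel X X} {f : X → ℝ}

instance isMarkovKernel_pow (P : Kernel X X) [IsMarkovKernel P] (k : ℕ) :
    IsMarkovKernel (P ^ k) := by
  induction k with
  | zero => rw [pow_zero]; exact inferInstanceAs (IsMarkovKernel Kernel.id)
  | succ k ih => rw [pow_succ]; exact inferInstanceAs (IsMarkovKernel ((P ^ k) ∘ₖ P))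

lemma integral_pow_zero (P : Kernel X X) (hf : Measurable f) (x : X) :
    ∫ y, f y ∂(P ^ 0) x = f x := by
  rw [pow_zero]
  exact (congrArg (∫ y, f y ∂·) (Kernel.id_apply x)).trans
    (integral_dirac' _ _ hf.stronglyMeasurable)

lemma integral_pow_add (P : Kernel X X) [IsMarkovKernel P] (hf : IsBddMeasurable f) (j k : ℕ)
    (x : X) : ∫ y, f y ∂(P ^ (j + k)) x = ∫ z, ∫ y, f y ∂(P ^ j) z ∂(P ^ k) x := by
  have : IsMarkovKernel ((P ^ j) ∘ₖ (P ^ k)) := by rw [← Kernel.pow_add]; infer_instance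
  rw [Kernel.pow_add, Kernel.integral_comp (hf.integrable _)]

lemma tendsto_pow_div_mul {t : ℕ} (ht : 0 < t) {β : ℝ} (hβ : 0 ≤ β) (hβ1 : β < 1) (R : ℝ) :
    Tendsto (fun k : ℕ => β ^ (k / t) * R) atTop (𝓝 0) := by
  simpa using ((tendsto_pow_atTop_nhds_zero_of_lt_one hβ hβ1).comp
    (Nat.tendsto_div_const_atTop ht.ne')).mul_const R

/-- The `t`-step kernel contracts total variation by the factor `β`: Dobrushin's ergodicity
coefficient of `P ^ t` is at most `β`. The factor `2` reflects the normalisation of `tvDist`. -/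
def IsTVContraction (P : Kernel X X) (t : ℕ) (β : ℝ) : Prop :=
  ∀ x x', tvDist ((P ^ t) x) ((P ^ t) x') ≤ 2 * β

namespace IsTVContraction

variable {t : ℕ} {β : ℝ} [IsMarkovKernel P]

lemma abs_integral_sub_le (h : IsTVContraction P t β) (hf : IsBddMeasurable f) {R : ℝ}
    (hR : ∀ y y', |f y - f y'| ≤ R) (x x' : X) :
    |∫ y, f y ∂(P ^ t) x - ∫ y, f y ∂(P ^ t) x'| ≤ β * R := by
  have hR0 : 0 ≤ R := (abs_nonneg _).trans (hR x x)
  calc |∫ y, f y ∂(P ^ t) x - ∫ y, f y ∂(P ^ t) x'|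
      ≤ R / 2 * tvDist ((P ^ t) x) ((P ^ t) x') := abs_integral_sub_le_half_mul_tvDist hf hR
    _ ≤ R / 2 * (2 * β) := by gcongr; exact h x x'
    _ = β * R := by ring

lemma abs_integral_pow_sub_le (h : IsTVContraction P t β) (hf : Measurable f) {M : ℝ}
    (hM : ∀ x, |f x| ≤ M) (r j : ℕ) (x x' : X) :
    |∫ y, f y ∂(P ^ (r + t * j)) x - ∫ y, f y ∂(P ^ (r + t * j)) x'| ≤ β ^ j * (2 * M) := by
  induction j generalizing x x' with
  | zero =>
    refine (abs_sub _ _).trans ?_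
    linarith [abs_integral_le_of_abs_le (μ := (P ^ (r + t * 0)) x) hM,
      abs_integral_le_of_abs_le (μ := (P ^ (r + t * 0)) x') hM]
  | succ j ih =>
    have hf' : IsBddMeasurable f := ⟨hf, M, hM⟩
    rw [mul_add_one, ← add_assoc, integral_pow_add P hf', integral_pow_add P hf', pow_succ',
      mul_assoc]
    exact h.abs_integral_sub_le (hf'.integral_kernel _) ih x x'

lemma abs_integral_pow_sub_le_pow_div (h : IsTVContraction P t β) (hf : Measurable f) {M : ℝ}
    (hM : ∀ x, |f x| ≤ M) (k : ℕ) (x x' : X) :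
    |∫ y, f y ∂(P ^ k) x - ∫ y, f y ∂(P ^ k) x'| ≤ β ^ (k / t) * (2 * M) := by
  simpa only [Nat.mod_add_div] using h.abs_integral_pow_sub_le hf hM (k % t) (k / t) x x'

lemma abs_integral_pow_sub_le_of_le (h : IsTVContraction P t β) (hf : Measurable f) {M : ℝ}
    (hM : ∀ x, |f x| ≤ M) {k l : ℕ} (hkl : k ≤ l) (x : X) :
    |∫ y, f y ∂(P ^ k) x - ∫ y, f y ∂(P ^ l) x| ≤ β ^ (k / t) * (2 * M) := by
  obtain ⟨n, rfl⟩ := Nat.exists_eq_add_of_le hkl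
  have hf' : IsBddMeasurable f := ⟨hf, M, hM⟩
  have hmean : ∫ z, (∫ y, f y ∂(P ^ k) x - ∫ y, f y ∂(P ^ k) z) ∂(P ^ n) x
      = ∫ y, f y ∂(P ^ k) x - ∫ y, f y ∂(P ^ (k + n)) x := by
    rw [integral_sub (integrable_const _) ((hf'.integral_kernel _).integrable _),
      integral_pow_add P hf']
    simp
  rw [← hmean]
  exact abs_integral_le_of_abs_le (h.abs_integral_pow_sub_le_pow_div hf hM k x)

lemma exists_tendsto_integral_pow (h : IsTVContraction P t β) (ht : 0 < t) (hβ : 0 ≤ β)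
    (hβ1 : β < 1) (hf : Measurable f) {M : ℝ} (hM : ∀ x, |f x| ≤ M) (x : X) :
    ∃ g, Tendsto (fun k => ∫ y, f y ∂(P ^ k) x) atTop (𝓝 g) ∧
      ∀ k : ℕ, |∫ y, f y ∂(P ^ k) x - g| ≤ β ^ (k / t) * (2 * M) := by
  have hstep : ∀ k l, k ≤ l →
      dist (∫ y, f y ∂(P ^ k) x) (∫ y, f y ∂(P ^ l) x) ≤ β ^ (k / t) * (2 * M) :=
    fun k l hkl => h.abs_integral_pow_sub_le_of_le hf hM hkl x
  have hrate := tendsto_pow_div_mul ht hβ hβ1 (2 * M)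
  obtain ⟨g, hg⟩ := cauchySeq_tendsto_of_complete (cauchySeq_of_le_tendsto_0' _ hstep hrate)
  exact ⟨g, hg, fun k => le_of_tendsto (tendsto_const_nhds.sub hg).abs
    ((eventually_ge_atTop k).mono (hstep k))⟩

end IsTVContraction

end Contraction

/-! ### Every ergodicity condition implies a contraction -/

section Ergodicity

variable {X U : Type*} [MeasurableSpace X] [MeasurableSpace U] {𝒮 : Set (Kernel (X × U) X)}

instance (T : Kernel (X × U) X) [IsMarkovKernel T] (γ : StationaryPolicy X U) :
    IsMarkovKernel (closedLoop T γ) := by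
  unfold closedLoop; infer_instance

lemma ErgAtom.ergMinorant (h : ErgAtom 𝒮) : ErgMinorant 𝒮 := by
  obtain ⟨β, hβ, h⟩ := h
  refine ⟨1, one_pos, β, hβ, fun T hT => ?_⟩
  obtain ⟨z, hz⟩ := h T hT
  refine ⟨β • Measure.dirac z, by simp, fun x γ => Measure.le_iff.2 fun s hs => ?_⟩
  rw [pow_one, Measure.smul_apply, Measure.dirac_apply' _ hs, smul_eq_mul]
  by_cases hzs : z ∈ s
  · rw [Set.indicator_of_mem hzs, Pi.one_apply, mul_one]
    exact (hz x γ).trans (measure_mono (Set.singleton_subset_iff.2 hzs))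
  · simp [hzs]

lemma ErgDensity.ergMinorant (h : ErgDensity 𝒮) : ErgMinorant 𝒮 := by
  obtain ⟨δ, hδ, h⟩ := h
  refine ⟨1, one_pos, δ, hδ, fun T hT => ?_⟩
  obtain ⟨m, -, p₀, -, hδp, hp⟩ := h T hT
  refine ⟨m.withDensity p₀, by simpa using hδp, fun x γ => ?_⟩
  obtain ⟨p, hpm, hle⟩ := hp γ
  rw [pow_one, (hpm x).2]
  exact withDensity_mono (ae_of_all _ (hle x))

lemma ErgDensityOn.ergDensity (h : ErgDensityOn 𝒮) : ErgDensity 𝒮 := by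
  obtain ⟨ε, hε, δ, hδ, h⟩ := h
  refine ⟨ε * δ, ENNReal.mul_pos hε.ne' hδ.ne', fun T hT => ?_⟩
  obtain ⟨m, hm, D, hD, hδD, hp⟩ := h T hT
  refine ⟨m, hm, D.indicator fun _ => ε, measurable_const.indicator hD, ?_, fun γ => ?_⟩
  · rw [lintegral_indicator hD, setLIntegral_const]
    gcongr
  · obtain ⟨p, hpm, hle⟩ := hp γ
    refine ⟨p, hpm, fun x => Set.indicator_le (hle x)⟩

lemma ergContraction_of_minorant (h𝒮 : ∀ T ∈ 𝒮, IsMarkovKernel T) {t : ℕ} (ht : 0 < t)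
    {δ : ℝ≥0∞} (hδ : 0 < δ)
    (h : ∀ T ∈ 𝒮, ∀ γ : StationaryPolicy X U, ∃ μ : Measure X, δ ≤ μ Set.univ ∧
      ∀ x, μ ≤ (closedLoop T γ ^ t) x) : ErgContraction 𝒮 := by
  have hhalf : min δ 2⁻¹ ≤ 2⁻¹ := min_le_right _ _
  have htop : min δ 2⁻¹ ≠ ∞ := ne_top_of_le_ne_top (by simp) hhalf
  have hpos : 0 < (min δ 2⁻¹).toReal := ENNReal.toReal_pos (by simp [hδ.ne']) htop
  have hle : (min δ 2⁻¹).toReal ≤ 2⁻¹ := by simpa using ENNReal.toReal_mono (by simp) hhalf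
  refine ⟨t, ht, 1 - (min δ 2⁻¹).toReal, by linarith, by linarith, fun T hT x x' γ => ?_⟩
  have := h𝒮 T hT
  obtain ⟨μ, hμ, hμle⟩ := h T hT γ
  have := isFiniteMeasure_of_le _ (hμle x)
  have hmass : (min δ 2⁻¹).toReal ≤ μ.real Set.univ :=
    ENNReal.toReal_mono (measure_ne_top μ _) ((min_le_left _ _).trans hμ)
  linarith [tvDist_le_of_minorant (hμle x) (hμle x')]

lemma ErgMinorant.ergContraction (h𝒮 : ∀ T ∈ 𝒮, IsMarkovKernel T) (h : ErgMinorant 𝒮) :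
    ErgContraction 𝒮 := by
  obtain ⟨t, ht, δ, hδ, h⟩ := h
  refine ergContraction_of_minorant h𝒮 ht hδ fun T hT γ => ?_
  obtain ⟨μ, hμ, hle⟩ := h T hT
  exact ⟨μ, hμ, fun x => hle x γ⟩

lemma ErgDoeblin.ergContraction (h𝒮 : ∀ T ∈ 𝒮, IsMarkovKernel T) (h : ErgDoeblin 𝒮) :
    ErgContraction 𝒮 := by
  obtain ⟨t, ht, β, hβ, h⟩ := h
  refine ergContraction_of_minorant h𝒮 ht hβ fun T hT γ => ?_
  obtain ⟨μ, hμ, hle⟩ := h T hT γ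
  exact ⟨β • μ, by simp, hle⟩

lemma ErgMajorant.ergContraction (h𝒮 : ∀ T ∈ 𝒮, IsMarkovKernel T) (h : ErgMajorant 𝒮) :
    ErgContraction 𝒮 := by
  obtain ⟨t, ht, M, hM, h⟩ := h
  have hMtop : M ≠ ∞ := (hM.trans ENNReal.ofNat_lt_top).ne
  have hM2 : M.toReal < 2 := by
    simpa using (ENNReal.toReal_lt_toReal hMtop ENNReal.ofNat_ne_top).2 hM
  refine ⟨t, ht, max M.toReal (3 / 2) - 1, ?_, ?_, fun T hT x x' γ => ?_⟩
  · linarith [le_max_right M.toReal (3 / 2)]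
  · linarith [max_lt hM2 (by norm_num : (3 / 2 : ℝ) < 2)]
  · have := h𝒮 T hT
    obtain ⟨μ, hμ, hμle⟩ := h T hT
    have : IsFiniteMeasure μ := ⟨hμ.trans_lt hMtop.lt_top⟩
    have hmass : μ.real Set.univ ≤ M.toReal := ENNReal.toReal_mono hMtop hμ
    linarith [tvDist_le_of_majorant (hμle x γ) (hμle x' γ), le_max_left M.toReal (3 / 2)]

lemma ErgGeometric.ergUniform (h : ErgGeometric 𝒮) : ErgUniform 𝒮 := by
  obtain ⟨C, β, -, hβ, hβ1, h⟩ := h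
  choose! π hπ hle using h
  have hlim : Tendsto (fun t : ℕ => C * β ^ t) atTop (𝓝 0) := by
    simpa using (tendsto_pow_atTop_nhds_zero_of_lt_one hβ.le hβ1).const_mul C
  refine ⟨π, hπ, fun ε hε => ?_⟩
  obtain ⟨t₀, ht₀⟩ :=
    eventually_atTop.1 ((hlim.eventually (ge_mem_nhds hε)).and (eventually_gt_atTop 0))
  exact ⟨t₀, fun t ht T hT γ x => (hle T hT γ x t (ht₀ t ht).2).trans (ht₀ t ht).1⟩

lemma ErgUniform.ergContraction (h𝒮 : ∀ T ∈ 𝒮, IsMarkovKernel T) (h : ErgUniform 𝒮) :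
    ErgContraction 𝒮 := by
  obtain ⟨π, hπ, h⟩ := h
  obtain ⟨t₀, ht₀⟩ := h (1 / 2) (by norm_num)
  refine ⟨t₀ + 1, t₀.succ_pos, 1 / 2, by norm_num, by norm_num, fun T hT x x' γ => ?_⟩
  have := h𝒮 T hT
  have := hπ T hT γ
  have hclose := ht₀ (t₀ + 1) t₀.le_succ T hT γ
  have htri := tvDist_triangle ((closedLoop T γ ^ (t₀ + 1)) x) (π T γ)
    ((closedLoop T γ ^ (t₀ + 1)) x')
  rw [tvDist_comm (π T γ)] at htri
  linarith [hclose x, hclose x']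

lemma UniformlyErgodic.ergContraction (h𝒮 : ∀ T ∈ 𝒮, IsMarkovKernel T)
    (h : UniformlyErgodic 𝒮) : ErgContraction 𝒮 := by
  rcases h with h | h | h | h | h | h | h | h | h
  · exact h.ergMinorant.ergContraction h𝒮
  · exact h.ergContraction h𝒮
  · exact h.ergDensity.ergMinorant.ergContraction h𝒮
  · exact h.ergMinorant.ergContraction h𝒮
  · exact h.ergContraction h𝒮
  · exact h
  · exact h.ergContraction h𝒮
  · exact h.ergUniform.ergContraction h𝒮
  · exact h.ergContraction h𝒮

lemma ErgContraction.exists_isTVContraction (h : ErgContraction 𝒮) :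
    ∃ t : ℕ, 0 < t ∧ ∃ β : ℝ, 0 < β ∧ β < 1 ∧ ∀ T ∈ 𝒮, ∀ γ : StationaryPolicy X U,
      IsTVContraction (closedLoop T γ) t β :=
  let ⟨t, ht, β, hβ, hβ1, h⟩ := h
  ⟨t, ht, β, hβ, hβ1, fun T hT γ x x' => h T hT x x' γ⟩

end Ergodicity

/-! ### The law of the controlled process -/

section ProcessLaw

variable {X U : Type*} [MeasurableSpace X] [MeasurableSpace U]

lemma kernel_comp_measure_map {α β γ : Type*} [MeasurableSpace α] [MeasurableSpace β]
    [MeasurableSpace γ] (κ : Kernel β γ) (μ : Measure α) {f : α → β} (hf : Measurable f) :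
    κ ∘ₘ μ.map f = κ.comap f hf ∘ₘ μ := by
  rw [← Measure.deterministic_comp_eq_map hf, Measure.comp_assoc,
    Kernel.comp_deterministic_eq_comap]

instance (T : Kernel (X × U) X) [IsMarkovKernel T] (γ : Policy X U) (x₀ : X) :
    IsProbabilityMeasure (processLaw T γ x₀) := by
  unfold processLaw; infer_instance

lemma processLaw_map_frestrictLe_zero (T : Kernel (X × U) X) [IsMarkovKernel T]
    (γ : Policy X U) (x₀ : X) :
    (processLaw T γ x₀).map (Preorder.frestrictLe (π := fun _ => X × U) 0)
      = Measure.dirac fun _ => (x₀, γ.act 0 Fin.elim0 x₀) := by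
  rw [processLaw, Kernel.traj_map_frestrictLe_apply, Kernel.partialTraj_self, Kernel.id_apply]

lemma processLaw_map_eval (T : Kernel (X × U) X) [IsMarkovKernel T] (γ : Policy X U) (x₀ : X)
    (t : ℕ) : (processLaw T γ x₀).map (fun ω => ω t)
      = ((processLaw T γ x₀).map (Preorder.frestrictLe (π := fun _ => X × U) t)).map
        (histLast t) := by
  rw [Measure.map_map (measurable_histLast t) (Preorder.measurable_frestrictLe t)]
  rfl

lemma processLaw_map_eval_zero (T : Kernel (X × U) X) [IsMarkovKernel T]
    (γ : Policy X U) (x₀ : X) :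
    (processLaw T γ x₀).map (fun ω => ω 0) = Measure.dirac (x₀, γ.act 0 Fin.elim0 x₀) := by
  rw [processLaw_map_eval, processLaw_map_frestrictLe_zero,
    Measure.map_dirac' (measurable_histLast 0)]
  rfl

lemma processLaw_map_eval_succ (T : Kernel (X × U) X) [IsMarkovKernel T] (γ : Policy X U)
    (x₀ : X) (t : ℕ) : (processLaw T γ x₀).map (fun ω => ω (t + 1))
      = stepKernel T γ t ∘ₘ
        (processLaw T γ x₀).map (Preorder.frestrictLe (π := fun _ => X × U) t) := by
  have hev : Measurable fun ω : ℕ → X × U => ω (t + 1) := measurable_pi_apply _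
  have h := Kernel.traj_comp_partialTraj (X := fun _ => X × U) (κ := stepKernel T γ)
    (Nat.zero_le t)
  rw [← Kernel.traj_map_frestrictLe] at h
  rw [← Kernel.map_traj_succ_self (X := fun _ => X × U) (κ := stepKernel T γ),
    ← Measure.map_comp _ _ hev]
  congr 1
  rw [processLaw]
  nth_rw 1 [← h]
  rw [Kernel.comp_apply, Kernel.map_apply _ (Preorder.measurable_frestrictLe t)]

lemma processLaw_map_comp_eval_succ (T : Kernel (X × U) X) [IsMarkovKernel T] (γ : Policy X U)
    (x₀ : X) (t : ℕ) {Z : Type*} [MeasurableSpace Z] {g : X × U → Z} (hg : Measurable g)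
    {φ : X → Z} (hφ : Measurable φ) (h : ∀ p, g (nextPair γ t p) = φ p.2) :
    (processLaw T γ x₀).map (fun ω => g (ω (t + 1)))
      = T.map φ ∘ₘ (processLaw T γ x₀).map fun ω => ω t := by
  have hstep : (stepKernel T γ t).map g = (T.map φ).comap (histLast t) (measurable_histLast t) := by
    rw [stepKernel, ← Kernel.map_comp_right _ (measurable_nextPair γ t) hg,
      show g ∘ nextPair γ t = φ ∘ Prod.snd from funext h,
      Kernel.map_comp_right _ measurable_snd hφ, ← Kernel.snd_eq, Kernel.snd_prod,
      ← Kernel.comap_map_comm _ _ hφ]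
  rw [processLaw_map_eval, kernel_comp_measure_map _ _ (measurable_histLast t), ← hstep,
    ← Measure.map_comp _ _ hg, ← processLaw_map_eval_succ,
    Measure.map_map hg (measurable_pi_apply _)]
  rfl

lemma processLaw_map_eval_toPolicy (T : Kernel (X × U) X) [IsMarkovKernel T]
    (γ : StationaryPolicy X U) (x₀ : X) (t : ℕ) :
    (processLaw T γ.toPolicy x₀).map (fun ω => ω t)
      = ((closedLoop T γ ^ t) x₀).map fun x => (x, γ.act x) := by
  have hφ : Measurable fun x => (x, γ.act x) := measurable_id.prodMk γ.measurable_act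
  induction t with
  | zero =>
    rw [processLaw_map_eval_zero, pow_zero]
    exact (Measure.map_dirac' hφ x₀).symm
  | succ t ih =>
    have hlaw := processLaw_map_comp_eval_succ T γ.toPolicy x₀ t (g := id) measurable_id hφ
      fun _ => rfl
    simp only [id] at hlaw
    rw [hlaw, ih, kernel_comp_measure_map _ _ hφ, Kernel.comap_map_comm _ hφ hφ,
      ← Measure.map_comp _ _ hφ, pow_succ']
    rfl

lemma integral_processLaw_toPolicy (T : Kernel (X × U) X) [IsMarkovKernel T]
    (γ : StationaryPolicy X U) (x₀ : X) {f : X × U → ℝ} (hf : Measurable f) (t : ℕ) :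
    ∫ ω, f (ω t) ∂(processLaw T γ.toPolicy x₀)
      = ∫ x, f (x, γ.act x) ∂((closedLoop T γ ^ t) x₀) := by
  have hφ : Measurable fun x => (x, γ.act x) := measurable_id.prodMk γ.measurable_act
  rw [← integral_map (measurable_pi_apply t).aemeasurable hf.aestronglyMeasurable,
    processLaw_map_eval_toPolicy, integral_map hφ.aemeasurable hf.aestronglyMeasurable]

lemma integral_fst_processLaw_succ (T : Kernel (X × U) X) [IsMarkovKernel T] (γ : Policy X U)
    (x₀ : X) {h : X → ℝ} (hh : IsBddMeasurable h) (t : ℕ) :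
    ∫ ω, h (ω (t + 1)).1 ∂(processLaw T γ x₀)
      = ∫ ω, ∫ y, h y ∂T (ω t) ∂(processLaw T γ x₀) := by
  have hlaw := processLaw_map_comp_eval_succ T γ x₀ t measurable_fst measurable_id fun _ => rfl
  have hmeas := (hh.integral_kernel T).measurable
  calc ∫ ω, h (ω (t + 1)).1 ∂(processLaw T γ x₀)
      = ∫ x, h x ∂((processLaw T γ x₀).map fun ω => (ω (t + 1)).1) :=
        (integral_map (measurable_pi_apply (t + 1)).fst.aemeasurable
          hh.measurable.aestronglyMeasurable).symm
    _ = ∫ p, ∫ y, h y ∂T p ∂((processLaw T γ x₀).map fun ω => ω t) := by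
        have : IsProbabilityMeasure ((processLaw T γ x₀).map fun ω => ω t) :=
          Measure.isProbabilityMeasure_map (measurable_pi_apply t).aemeasurable
        rw [hlaw, Kernel.map_id, Measure.comp_eq_comp_const_apply,
          Kernel.integral_comp (hh.integrable _), Kernel.const_apply]
    _ = ∫ ω, ∫ y, h y ∂T (ω t) ∂(processLaw T γ x₀) :=
        integral_map (measurable_pi_apply t).aemeasurable hmeas.aestronglyMeasurable

lemma avgCost_eq {c : X × U → ℝ} (hc : IsBddMeasurable c) (T : Kernel (X × U) X)
    [IsMarkovKernel T] (γ : Policy X U) (x₀ : X) :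
    avgCost c T γ x₀ = limsup (fun N : ℕ =>
      (N : ℝ)⁻¹ * ∑ t ∈ Finset.range N, ∫ ω, c (ω t) ∂(processLaw T γ x₀)) atTop := by
  simp only [avgCost, one_div]
  congr! with N
  exact integral_finsetSum _ fun t _ => (hc.comp (measurable_pi_apply t)).integrable _

lemma abs_integral_sub_avgCost_le {c : X × U → ℝ} (hc : Measurable c) {M : ℝ}
    (hM : ∀ p, |c p| ≤ M) (T : Kernel (X × U) X) [IsMarkovKernel T] (γ : StationaryPolicy X U)
    {t : ℕ} (ht : 0 < t) {β : ℝ} (hβ : 0 ≤ β) (hβ1 : β < 1)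
    (h : IsTVContraction (closedLoop T γ) t β) (x₀ : X) (k : ℕ) :
    |∫ x, c (x, γ.act x) ∂((closedLoop T γ ^ k) x₀) - avgCost c T γ.toPolicy x₀|
      ≤ β ^ (k / t) * (2 * M) := by
  have hφ : Measurable fun x => (x, γ.act x) := measurable_id.prodMk γ.measurable_act
  obtain ⟨g, hg, hk⟩ := h.exists_tendsto_integral_pow ht hβ hβ1 (f := fun x => c (x, γ.act x))
    (hc.comp hφ) (fun _ => hM _) x₀
  rw [avgCost_eq ⟨hc, M, hM⟩]
  simp only [integral_processLaw_toPolicy T γ x₀ hc]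
  rw [hg.cesaro.limsup_eq]
  exact hk k

end ProcessLaw

/-! ### Averages -/

section Averages

variable {a v : ℕ → ℝ} {M B L : ℝ}

lemma abs_average_le (hM : ∀ t, |a t| ≤ M) (N : ℕ) :
    |(N : ℝ)⁻¹ * ∑ t ∈ Finset.range N, a t| ≤ M := by
  have hM0 : 0 ≤ M := (abs_nonneg _).trans (hM 0)
  have hsum : |∑ t ∈ Finset.range N, a t| ≤ N * M := by
    refine (Finset.abs_sum_le_sum_abs _ _).trans ((Finset.sum_le_sum fun t _ => hM t).trans ?_)
    simp
  rw [abs_mul, abs_of_nonneg (by positivity : (0 : ℝ) ≤ (N : ℝ)⁻¹)]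
  exact inv_mul_le_of_le_mul₀ N.cast_nonneg hM0 hsum

lemma isBoundedUnder_le_average (hM : ∀ t, |a t| ≤ M) :
    IsBoundedUnder (· ≤ ·) atTop fun N : ℕ => (N : ℝ)⁻¹ * ∑ t ∈ Finset.range N, a t :=
  isBoundedUnder_of ⟨M, fun N => (abs_le.1 (abs_average_le hM N)).2⟩

lemma isBoundedUnder_ge_average (hM : ∀ t, |a t| ≤ M) :
    IsBoundedUnder (· ≥ ·) atTop fun N : ℕ => (N : ℝ)⁻¹ * ∑ t ∈ Finset.range N, a t :=
  isBoundedUnder_of ⟨-M, fun N => (abs_le.1 (abs_average_le hM N)).1⟩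

lemma tendsto_telescoping_average (hB : ∀ t, |v t| ≤ B) (L : ℝ) :
    Tendsto (fun N : ℕ => (N : ℝ)⁻¹ * ∑ t ∈ Finset.range N, (v t - v (t + 1) + L))
      atTop (𝓝 L) := by
  have hbdd : IsBoundedUnder (· ≤ ·) atTop (norm ∘ fun N => v 0 - v N) :=
    isBoundedUnder_of ⟨B + B, fun N => (norm_sub_le _ _).trans (add_le_add (hB 0) (hB N))⟩
  have hend : Tendsto (fun N : ℕ => (N : ℝ)⁻¹ * (v 0 - v N) + L) atTop (𝓝 L) := by
    simpa using
      (tendsto_inv_atTop_nhds_zero_nat.zero_mul_isBoundedUnder_le hbdd).add_const L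
  refine hend.congr' ?_
  filter_upwards [eventually_gt_atTop 0] with N hN
  rw [Finset.sum_add_distrib, Finset.sum_range_sub', Finset.sum_const, Finset.card_range,
    nsmul_eq_mul]
  field_simp

lemma le_limsup_average (hM : ∀ t, |a t| ≤ M) (hB : ∀ t, |v t| ≤ B)
    (h : ∀ t, v t - v (t + 1) + L ≤ a t) :
    L ≤ limsup (fun N : ℕ => (N : ℝ)⁻¹ * ∑ t ∈ Finset.range N, a t) atTop := by
  have hL := tendsto_telescoping_average hB L
  rw [← hL.limsup_eq]
  refine limsup_le_limsup (Eventually.of_forall fun N => ?_)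
    hL.isBoundedUnder_ge.isCoboundedUnder_le (isBoundedUnder_le_average hM)
  beta_reduce
  gcongr
  exact h _

lemma limsup_average_le (hM : ∀ t, |a t| ≤ M) (hB : ∀ t, |v t| ≤ B)
    (h : ∀ t, a t ≤ v t - v (t + 1) + L) :
    limsup (fun N : ℕ => (N : ℝ)⁻¹ * ∑ t ∈ Finset.range N, a t) atTop ≤ L := by
  have hL := tendsto_telescoping_average hB L
  rw [← hL.limsup_eq]
  refine limsup_le_limsup (Eventually.of_forall fun N => ?_)
    (isBoundedUnder_ge_average hM).isCoboundedUnder_le hL.isBoundedUnder_le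
  beta_reduce
  gcongr
  exact h _

end Averages

/-! ### Verification for the average cost -/

section Verification

variable {X U : Type*} [MeasurableSpace X] [MeasurableSpace U]

/-- The action value (Q-function) with discount factor `α` and value function `V`: the cost of the
state-action pair `p` plus the discounted expected value of the next state. The undiscounted case
`α = 1` is the one occurring in the average cost optimality equation. -/
noncomputable def actionValue (c : X × U → ℝ) (T : Kernel (X × U) X) (α : ℝ) (V : X → ℝ)
    (p : X × U) : ℝ :=
  c p + α * ∫ y, V y ∂T p

variable {c : X × U → ℝ} {T : Kernel (X × U) X} [IsMarkovKernel T]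

lemma IsBddMeasurable.actionValue (hc : IsBddMeasurable c) (α : ℝ) {V : X → ℝ}
    (hV : IsBddMeasurable V) : IsBddMeasurable (actionValue c T α V) :=
  hc.add ((hV.integral_kernel T).const_mul α)

lemma integral_actionValue_processLaw (hc : IsBddMeasurable c) {h : X → ℝ}
    (hh : IsBddMeasurable h) (γ : Policy X U) (x₀ : X) (t : ℕ) :
    ∫ ω, actionValue c T 1 h (ω t) ∂(processLaw T γ x₀)
      = ∫ ω, c (ω t) ∂(processLaw T γ x₀) + ∫ ω, h (ω (t + 1)).1 ∂(processLaw T γ x₀) := by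
  have hev := measurable_pi_apply (X := fun _ => X × U) t
  simp only [actionValue, one_mul]
  rw [integral_add ((hc.comp hev).integrable _) (((hh.integral_kernel T).comp hev).integrable _),
    integral_fst_processLaw_succ T γ x₀ hh]

lemma le_avgCost_of_le_actionValue (hc : IsBddMeasurable c) {h : X → ℝ} (hh : IsBddMeasurable h)
    {g : ℝ} (hg : ∀ p, g + h p.1 ≤ actionValue c T 1 h p) (γ : Policy X U) (x₀ : X) :
    g ≤ avgCost c T γ x₀ := by
  obtain ⟨M, hM⟩ := hc.exists_bound
  obtain ⟨B, hB⟩ := hh.exists_bound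
  rw [avgCost_eq hc]
  refine le_limsup_average (v := fun t => ∫ ω, h (ω t).1 ∂(processLaw T γ x₀))
    (fun t => abs_integral_le_of_abs_le fun _ => hM _)
    (fun t => abs_integral_le_of_abs_le fun _ => hB _) fun t => ?_
  have hev := measurable_pi_apply (X := fun _ => X × U) t
  have hint : ∫ ω, (g + h (ω t).1) ∂(processLaw T γ x₀)
      ≤ ∫ ω, actionValue c T 1 h (ω t) ∂(processLaw T γ x₀) :=
    integral_mono ((integrable_const g).add ((hh.comp hev.fst).integrable _))
      (((hc.actionValue 1 hh).comp hev).integrable _) fun ω => hg (ω t)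
  rw [integral_actionValue_processLaw hc hh,
    integral_add (integrable_const g) ((hh.comp hev.fst).integrable _)] at hint
  simp only [integral_const, probReal_univ, one_smul] at hint
  linarith

lemma avgCost_toPolicy_le_of_actionValue_le (hc : IsBddMeasurable c) {h : X → ℝ}
    (hh : IsBddMeasurable h) {g : ℝ} {γ : StationaryPolicy X U}
    (hg : ∀ x, actionValue c T 1 h (x, γ.act x) ≤ g + h x) (x₀ : X) :
    avgCost c T γ.toPolicy x₀ ≤ g := by
  obtain ⟨M, hM⟩ := hc.exists_bound
  obtain ⟨B, hB⟩ := hh.exists_bound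
  rw [avgCost_eq hc]
  refine limsup_average_le (v := fun t => ∫ ω, h (ω t).1 ∂(processLaw T γ.toPolicy x₀))
    (fun t => abs_integral_le_of_abs_le fun _ => hM _)
    (fun t => abs_integral_le_of_abs_le fun _ => hB _) fun t => ?_
  have hact : IsBddMeasurable fun x => actionValue c T 1 h (x, γ.act x) :=
    (hc.actionValue 1 hh).comp (measurable_id.prodMk γ.measurable_act)
  have hint : ∫ x, actionValue c T 1 h (x, γ.act x) ∂((closedLoop T γ ^ t) x₀)
      ≤ ∫ x, (g + h x) ∂((closedLoop T γ ^ t) x₀) :=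
    integral_mono (hact.integrable _) ((integrable_const g).add (hh.integrable _)) hg
  rw [← integral_processLaw_toPolicy T γ x₀ (hc.actionValue 1 hh).measurable t,
    integral_actionValue_processLaw hc hh, integral_add (integrable_const g) (hh.integrable _),
    ← integral_processLaw_toPolicy T γ x₀ (f := fun p => h p.1)
      (hh.measurable.comp measurable_fst) t] at hint
  simp only [integral_const, probReal_univ, one_smul] at hint
  linarith

lemma optCost_le (hc : IsBddMeasurable c) (γ : Policy X U) (x₀ : X) :
    optCost c T x₀ ≤ avgCost c T γ x₀ := by
  obtain ⟨M, hM⟩ := hc.exists_bound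
  refine ciInf_le ⟨-M, ?_⟩ γ
  rintro _ ⟨γ', rfl⟩
  exact le_avgCost_of_le_actionValue hc (h := 0) ⟨measurable_const, 0, by simp⟩
    (fun p => by simpa [actionValue] using (abs_le.1 (hM p)).1) γ' x₀

end Verification

/-! ### The discounted optimality equation -/

section Discounted

open TopologicalSpace (SeparableSpace denseSeq denseRange_denseSeq)

variable {X U : Type*} [MeasurableSpace X] [MeasurableSpace U]
  {c : X × U → ℝ} {T : Kernel (X × U) X} [IsMarkovKernel T] {α : ℝ}

lemma actionValue_le_add (hα : 0 ≤ α) {V W : X → ℝ} (hV : IsBddMeasurable V)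
    (hW : IsBddMeasurable W) {D : ℝ} (hVW : ∀ x, V x ≤ W x + D) (p : X × U) :
    actionValue c T α V p ≤ actionValue c T α W p + α * D := by
  have hint : ∫ y, V y ∂T p ≤ ∫ y, (W y + D) ∂T p :=
    integral_mono (hV.integrable _) ((hW.integrable _).add (integrable_const D)) hVW
  rw [integral_add (hW.integrable _) (integrable_const D)] at hint
  simp only [integral_const, probReal_univ, one_smul] at hint
  have hmul := mul_le_mul_of_nonneg_left hint hα
  unfold actionValue
  linarith

variable [TopologicalSpace U] [SeparableSpace U] [Nonempty U]

/-- The discounted Bellman operator. The infimum is taken over a countable dense set of actions, so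
that it preserves measurability; by continuity in the action this does not change its value. -/
noncomputable def bellman (c : X × U → ℝ) (T : Kernel (X × U) X) (α : ℝ) (V : X → ℝ) (x : X) : ℝ :=
  ⨅ j : ℕ, actionValue c T α V (x, denseSeq U j)

lemma bellman_le (hc : IsBddMeasurable c) {V : X → ℝ} (hV : IsBddMeasurable V) (x : X) (j : ℕ) :
    bellman c T α V x ≤ actionValue c T α V (x, denseSeq U j) :=
  have ⟨_, hB⟩ := (hc.actionValue (T := T) α hV).exists_bound
  ciInf_le ⟨_, Set.forall_mem_range.2 fun _ => (abs_le.1 (hB _)).1⟩ j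

lemma IsBddMeasurable.bellman (hc : IsBddMeasurable c) {V : X → ℝ} (hV : IsBddMeasurable V) :
    IsBddMeasurable (bellman c T α V) :=
  have hact := hc.actionValue (T := T) α hV
  have ⟨B, hB⟩ := hact.exists_bound
  ⟨Measurable.iInf fun _ => hact.measurable.comp measurable_prodMk_right, B, fun x =>
    abs_le.2 ⟨le_ciInf fun _ => (abs_le.1 (hB _)).1,
      (bellman_le hc hV x 0).trans (abs_le.1 (hB _)).2⟩⟩

lemma bellman_le_add (hc : IsBddMeasurable c) (hα : 0 ≤ α) {V W : X → ℝ}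
    (hV : IsBddMeasurable V) (hW : IsBddMeasurable W) {D : ℝ} (hVW : ∀ x, V x ≤ W x + D) (x : X) :
    bellman c T α V x ≤ bellman c T α W x + α * D := by
  rw [← sub_le_iff_le_add]
  refine le_ciInf fun j => sub_le_iff_le_add.2 ?_
  exact (bellman_le hc hV x j).trans (actionValue_le_add hα hV hW hVW _)

lemma abs_bellman_sub_le (hc : IsBddMeasurable c) (hα : 0 ≤ α) {V W : X → ℝ}
    (hV : IsBddMeasurable V) (hW : IsBddMeasurable W) {D : ℝ} (hVW : ∀ x, |V x - W x| ≤ D)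
    (x : X) : |bellman c T α V x - bellman c T α W x| ≤ α * D :=
  abs_sub_le_iff.2
    ⟨sub_le_iff_le_add'.2 <| bellman_le_add hc hα hV hW (fun y =>
      sub_le_iff_le_add'.1 (abs_sub_le_iff.1 (hVW y)).1) x,
    sub_le_iff_le_add'.2 <| bellman_le_add hc hα hW hV (fun y =>
      sub_le_iff_le_add'.1 (abs_sub_le_iff.1 (hVW y)).2) x⟩

lemma exists_approx_fixedPoint_bellman (hc : IsBddMeasurable c) (hα : 0 ≤ α) (hα1 : α < 1) {η : ℝ}
    (hη : 0 < η) : ∃ V, IsBddMeasurable V ∧ ∀ x, |bellman c T α V x - V x| ≤ η := by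
  let V (k : ℕ) : X → ℝ := (bellman c T α)^[k] 0
  have hV0 : IsBddMeasurable (V 0) := ⟨measurable_const, 0, by simp [V]⟩
  have hV_succ (k) : V (k + 1) = bellman c T α (V k) := Function.iterate_succ_apply' ..
  have hV (k) : IsBddMeasurable (V k) := by
    induction k with
    | zero => exact hV0
    | succ k ih => exact hV_succ k ▸ hc.bellman ih
  obtain ⟨M, hM⟩ := (hc.bellman (T := T) (α := α) hV0).exists_bound
  have hgeom (k x) : |bellman c T α (V k) x - V k x| ≤ α ^ k * M := by
    induction k generalizing x with
    | zero => simpa [V] using hM x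
    | succ k ih =>
      rw [hV_succ, pow_succ', mul_assoc]
      exact abs_bellman_sub_le hc hα (hc.bellman (hV k)) (hV k) ih x
  have hlim : Tendsto (fun k : ℕ => α ^ k * M) atTop (𝓝 0) := by
    simpa using (tendsto_pow_atTop_nhds_zero_of_lt_one hα hα1).mul_const M
  obtain ⟨k, hk⟩ := (hlim.eventually (gt_mem_nhds hη)).exists
  exact ⟨V k, hV k, fun x => (hgeom k x).trans hk.le⟩

lemma exists_actionValue_le_bellman_add (hc : IsBddMeasurable c) {V : X → ℝ}
    (hV : IsBddMeasurable V) {η : ℝ} (hη : 0 < η) : ∃ γ : StationaryPolicy X U, ∀ x,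
      actionValue c T α V (x, γ.act x) ≤ bellman c T α V x + η := by
  classical
  have hex (x : X) : ∃ j, actionValue c T α V (x, denseSeq U j) < bellman c T α V x + η :=
    exists_lt_of_ciInf_lt (lt_add_of_pos_right _ hη)
  have hfind : Measurable fun x => Nat.find (hex x) := measurable_find hex fun j =>
    measurableSet_lt ((hc.actionValue α hV).measurable.comp measurable_prodMk_right)
      ((hc.bellman hV).measurable.add_const η)
  exact ⟨⟨fun x => denseSeq U (Nat.find (hex x)), measurable_from_nat.comp hfind⟩,
    fun x => (Nat.find_spec (hex x)).le⟩

lemma bellman_le_actionValue (hc : IsBddMeasurable c) (hcu : ∀ x, Continuous fun u => c (x, u))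
    (hT : SetwiseContinuousInAction T) {V : X → ℝ} (hV : IsBddMeasurable V) (p : X × U) :
    bellman c T α V p.1 ≤ actionValue c T α V p := by
  have hcont : Continuous fun u => actionValue c T α V (p.1, u) :=
    (hcu p.1).add ((hT p.1 V hV.measurable hV.exists_bound).const_mul α)
  exact (denseRange_denseSeq U).induction_on
    (p := fun u => bellman c T α V p.1 ≤ actionValue c T α V (p.1, u)) p.2
    (isClosed_le continuous_const hcont) (bellman_le hc hV p.1)

lemma exists_approx_discounted_optimality_equation (hc : IsBddMeasurable c)
    (hcu : ∀ x, Continuous fun u => c (x, u)) (hT : SetwiseContinuousInAction T) (hα : 0 ≤ α)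
    (hα1 : α < 1) {η : ℝ} (hη : 0 < η) : ∃ V, IsBddMeasurable V ∧
      (∀ p : X × U, V p.1 ≤ actionValue c T α V p + η) ∧
      ∃ γ : StationaryPolicy X U, ∀ x, actionValue c T α V (x, γ.act x) ≤ V x + 2 * η := by
  obtain ⟨V, hV, hfix⟩ := exists_approx_fixedPoint_bellman (T := T) hc hα hα1 hη
  obtain ⟨γ, hγ⟩ := exists_actionValue_le_bellman_add (T := T) (α := α) hc hV hη
  refine ⟨V, hV, fun p => ?_, γ, fun x => ?_⟩
  · linarith [bellman_le_actionValue (α := α) hc hcu hT hV p, (abs_le.1 (hfix p.1)).1]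
  · linarith [hγ x, (abs_le.1 (hfix x)).2]

end Discounted

/-! ### Vanishing discount -/

section VanishingDiscount

section Oscillation

lemma abs_sub_le_div_of_self_bounding {X : Type*} {V : X → ℝ} {a β : ℝ} (hβ1 : β < 1)
    (hV : ∃ B, ∀ x, |V x| ≤ B)
    (h : ∀ R, (∀ x x', |V x - V x'| ≤ R) → ∀ x x', |V x - V x'| ≤ a + β * R) (x x' : X) :
    |V x - V x'| ≤ a / (1 - β) := by
  obtain ⟨B, hB⟩ := hV
  have : Nonempty (X × X) := ⟨(x, x')⟩
  let D (p : X × X) : ℝ := |V p.1 - V p.2|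
  have hbdd : BddAbove (Set.range D) := ⟨B + B, Set.forall_mem_range.2 fun p =>
    (abs_sub _ _).trans (add_le_add (hB _) (hB _))⟩
  have hsup : ⨆ p, D p ≤ a + β * ⨆ p, D p :=
    ciSup_le fun p => h _ (fun y y' => le_ciSup hbdd (y, y')) p.1 p.2
  exact (le_ciSup hbdd (x, x')).trans ((le_div_iff₀ (by linarith)).2 (by linarith))

variable {X : Type*} [MeasurableSpace X] {P : Kernel X X} [IsMarkovKernel P] {V : X → ℝ} {α ρ : ℝ}

lemma abs_integral_pow_sub_mul_le (hV : IsBddMeasurable V)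
    (hρ : ∀ x, |V x - α * ∫ y, V y ∂P x| ≤ ρ) (k : ℕ) (x : X) :
    |∫ y, V y ∂(P ^ k) x - α * ∫ y, V y ∂(P ^ (k + 1)) x| ≤ ρ := by
  have hPV := hV.integral_kernel P
  rw [add_comm k, integral_pow_add P hV, pow_one, ← integral_const_mul,
    ← integral_sub (hV.integrable _) ((hPV.const_mul α).integrable _)]
  exact abs_integral_le_of_abs_le hρ

lemma abs_sub_le_add_abs_integral_pow_sub (hα : 0 ≤ α) (hα1 : α ≤ 1) (hV : IsBddMeasurable V)
    (hρ : ∀ x, |V x - α * ∫ y, V y ∂P x| ≤ ρ) (k : ℕ) (x x' : X) :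
    |V x - V x'| ≤ k * (2 * ρ) + |∫ y, V y ∂(P ^ k) x - ∫ y, V y ∂(P ^ k) x'| := by
  induction k with
  | zero =>
    simp only [integral_pow_zero P hV.measurable, Nat.cast_zero, zero_mul, zero_add, le_refl]
  | succ k ih =>
    have hx := abs_integral_pow_sub_mul_le hV hρ k x
    have hx' := abs_integral_pow_sub_mul_le hV hρ k x'
    set a := ∫ y, V y ∂(P ^ k) x
    set a' := ∫ y, V y ∂(P ^ k) x'
    set b := ∫ y, V y ∂(P ^ (k + 1)) x
    set b' := ∫ y, V y ∂(P ^ (k + 1)) x'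
    have hstep : |a - a'| ≤ 2 * ρ + |b - b'| :=
      calc |a - a'| = |(a - α * b) - (a' - α * b') + α * (b - b')| := by ring_nf
        _ ≤ |a - α * b| + |a' - α * b'| + |α * (b - b')| :=
          (abs_add_le _ _).trans (add_le_add_left (abs_sub _ _) _)
        _ ≤ ρ + ρ + |b - b'| := by
          rw [abs_mul, abs_of_nonneg hα]
          gcongr
          exact mul_le_of_le_one_left (abs_nonneg _) hα1
        _ = 2 * ρ + |b - b'| := by ring
    push_cast
    linarith

lemma IsTVContraction.abs_sub_le {t : ℕ} {β : ℝ} (hP : IsTVContraction P t β) (hβ1 : β < 1)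
    (hα : 0 ≤ α) (hα1 : α ≤ 1) (hV : IsBddMeasurable V)
    (hρ : ∀ x, |V x - α * ∫ y, V y ∂P x| ≤ ρ) (x x' : X) :
    |V x - V x'| ≤ t * (2 * ρ) / (1 - β) :=
  abs_sub_le_div_of_self_bounding hβ1 hV.exists_bound (fun _ hR y y' =>
    (abs_sub_le_add_abs_integral_pow_sub hα hα1 hV hρ t y y').trans
      (add_le_add_right (hP.abs_integral_sub_le hV hR y y') _)) x x'

end Oscillation

variable {X U : Type*} [MeasurableSpace X] [MeasurableSpace U] {c : X × U → ℝ}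
  {T : Kernel (X × U) X} [IsMarkovKernel T]

lemma abs_actionValue_one_sub_le {s K : ℝ} (hs : 0 ≤ s) {V : X → ℝ} (hV : IsBddMeasurable V)
    {x₀ : X} (hK : ∀ x, |V x - V x₀| ≤ K) (p : X × U) :
    |actionValue c T 1 V p - actionValue c T (1 - s) V p - s * V x₀| ≤ s * K := by
  have hmean : |∫ y, (V y - V x₀) ∂T p| ≤ K := abs_integral_le_of_abs_le hK
  rw [integral_sub (hV.integrable _) (integrable_const _)] at hmean
  simp only [integral_const, probReal_univ, one_smul] at hmean
  calc |actionValue c T 1 V p - actionValue c T (1 - s) V p - s * V x₀|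
      = |s * (∫ y, V y ∂T p - V x₀)| := by rw [actionValue, actionValue]; ring_nf
    _ ≤ s * K := by rw [abs_mul, abs_of_nonneg hs]; gcongr

variable [TopologicalSpace U] [TopologicalSpace.SeparableSpace U] [Nonempty U]

lemma exists_approx_average_cost_optimality_equation (hc : IsBddMeasurable c)
    (hcu : ∀ x, Continuous fun u => c (x, u)) (hT : SetwiseContinuousInAction T) {t : ℕ} {β : ℝ}
    (hβ1 : β < 1) (hcon : ∀ γ : StationaryPolicy X U, IsTVContraction (closedLoop T γ) t β)
    (x₀ : X) {ε : ℝ} (hε : 0 < ε) :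
    ∃ (g : ℝ) (h : X → ℝ), IsBddMeasurable h ∧ (∀ p, g + h p.1 ≤ actionValue c T 1 h p) ∧
      ∃ γ : StationaryPolicy X U, ∀ x, actionValue c T 1 h (x, γ.act x) ≤ g + h x + ε := by
  obtain ⟨M, hM⟩ := hc.exists_bound
  have hM0 : 0 ≤ M := (abs_nonneg _).trans (hM (x₀, Classical.arbitrary U))
  set K : ℝ := t * (2 * (M + ε)) / (1 - β)
  have hK0 : 0 ≤ K := div_nonneg (by positivity) (by linarith)
  obtain ⟨s, hs, hs1, hsK⟩ : ∃ s : ℝ, 0 < s ∧ s ≤ 1 ∧ 2 * K * s ≤ ε / 4 := by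
    obtain ⟨s, hs, hsK⟩ := exists_pos_mul_lt (show 0 < ε / 4 by positivity) (2 * K)
    exact ⟨min s 1, by positivity, min_le_right _ _,
      (mul_le_mul_of_nonneg_left (min_le_left _ _) (mul_nonneg two_pos.le hK0)).trans hsK.le⟩
  obtain ⟨V, hV, hle, γ, hγ⟩ := exists_approx_discounted_optimality_equation (T := T) hc hcu hT
    (sub_nonneg.2 hs1) (sub_lt_self 1 hs) (show 0 < ε / 4 by positivity)
  have hosc (x : X) : |V x - V x₀| ≤ K := by
    refine (hcon γ).abs_sub_le hβ1 (sub_nonneg.2 hs1) (sub_le_self 1 hs.le) hV (fun y => ?_) x x₀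
    have hcy := abs_le.1 (hM (y, γ.act y))
    have hlow := hle (y, γ.act y)
    have hupp := hγ y
    change |V y - (1 - s) * ∫ z, V z ∂T (y, γ.act y)| ≤ M + ε
    unfold actionValue at hlow hupp
    exact abs_le.2 ⟨by linarith, by linarith⟩
  have hdisc (p : X × U) := abs_le.1 (abs_actionValue_one_sub_le (c := c) (T := T) hs.le hV hosc p)
  refine ⟨s * V x₀ - s * K - ε / 4, V, hV, fun p => ?_, γ, fun x => ?_⟩
  · linarith [hle p, (hdisc p).1]
  · linarith [hγ x, (hdisc (x, γ.act x)).2]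

lemma exists_avgCost_toPolicy_le_optCost_add (hc : IsBddMeasurable c)
    (hcu : ∀ x, Continuous fun u => c (x, u)) (hT : SetwiseContinuousInAction T) {t : ℕ} {β : ℝ}
    (hβ1 : β < 1) (hcon : ∀ γ : StationaryPolicy X U, IsTVContraction (closedLoop T γ) t β)
    (x₀ : X) {ε : ℝ} (hε : 0 < ε) :
    ∃ γ : StationaryPolicy X U, avgCost c T γ.toPolicy x₀ ≤ optCost c T x₀ + ε := by
  obtain ⟨g, h, hh, hle, γ, hγ⟩ :=
    exists_approx_average_cost_optimality_equation hc hcu hT hβ1 hcon x₀ hε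
  have : Nonempty (Policy X U) := ⟨γ.toPolicy⟩
  have hg : g ≤ optCost c T x₀ := le_ciInf fun π => le_avgCost_of_le_actionValue hc hh hle π x₀
  have hγg : avgCost c T γ.toPolicy x₀ ≤ g + ε :=
    avgCost_toPolicy_le_of_actionValue_le hc hh (fun x => (hγ x).trans_eq (by ring)) x₀
  exact ⟨γ, by linarith⟩

end VanishingDiscount

/-! ### Continuous convergence of kernels -/

section Convergence

lemma tendsto_extend_of_strictMono {Y : Type*} [TopologicalSpace Y] {m : ℕ → ℕ}
    (hm : StrictMono m) {v : ℕ → Y} {y : Y} (hv : Tendsto v atTop (𝓝 y)) :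
    Tendsto (Function.extend m v fun _ => y) atTop (𝓝 y) := by
  refine tendsto_def.2 fun W hW => ?_
  obtain ⟨K, hK⟩ := eventually_atTop.1 (hv.eventually_mem hW)
  filter_upwards [eventually_ge_atTop (m K)] with n hn
  by_cases hex : ∃ k, m k = n
  · obtain ⟨k, rfl⟩ := hex
    rw [Set.mem_preimage, hm.injective.extend_apply]
    exact hK k (hm.le_iff_le.1 hn)
  · rw [Set.mem_preimage, Function.extend_apply' _ _ _ hex]
    exact mem_of_mem_nhds hW

lemma tendsto_prod_nhds_of_forall_seq {Y Z : Type*} [TopologicalSpace Y]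
    [FirstCountableTopology Y] {l : Filter Z} {F : ℕ → Y → Z} {y : Y}
    (h : ∀ u : ℕ → Y, Tendsto u atTop (𝓝 y) → Tendsto (fun n => F n (u n)) atTop l) :
    Tendsto (fun p : ℕ × Y => F p.1 p.2) (atTop ×ˢ 𝓝 y) l := by
  refine tendsto_of_seq_tendsto fun z hz => tendsto_of_subseq_tendsto fun ns hns => ?_
  obtain ⟨hfst, hsnd⟩ := tendsto_prod_iff'.1 (hz.comp hns)
  obtain ⟨φ, hφ, hmono⟩ := strictMono_subseq_of_tendsto_atTop hfst
  have hext := h _ (tendsto_extend_of_strictMono hmono (hsnd.comp hφ.tendsto_atTop))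
  refine ⟨φ, (hext.comp hmono.tendsto_atTop).congr fun k => ?_⟩
  exact congrArg (F _) (hmono.injective.extend_apply _ _ _)

lemma tendsto_comp_of_forall_tendsto_prod_nhds {ι Y Z : Type*} [TopologicalSpace Y]
    [CompactSpace Y] {l : Filter ι} {l' : Filter Z} {F : ι → Y → Z}
    (h : ∀ y, Tendsto (fun p : ι × Y => F p.1 p.2) (l ×ˢ 𝓝 y) l') (u : ι → Y) :
    Tendsto (fun n => F n (u n)) l l' := by
  have hunif : Tendsto (fun p : ι × Y => F p.1 p.2) (l ×ˢ ⊤) l' := by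
    rw [← nhdsSet_univ, isCompact_univ.prod_nhdsSet_eq_biSup]
    exact tendsto_iSup.2 fun y => tendsto_iSup.2 fun _ => h y
  exact hunif.comp (tendsto_id.prodMk tendsto_top)

variable {ι X U : Type*} [MeasurableSpace X] [MeasurableSpace U] [TopologicalSpace U]

/-- Continuous convergence in total variation of controlled kernels, at every state: the kernels
converge jointly as the index runs along `l` and the action tends to a limit. For sequences and
first-countable action spaces this amounts to `‖Tₙ(·|x,uₙ) - T(·|x,u)‖ → 0` whenever `uₙ → u`. -/
def TendstoContinuouslyTV (Tn : ι → Kernel (X × U) X) (l : Filter ι) (T : Kernel (X × U) X) :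
    Prop :=
  ∀ x u, Tendsto (fun p : ι × U => tvDist (Tn p.1 (x, p.2)) (T (x, u))) (l ×ˢ 𝓝 u) (𝓝 0)

namespace TendstoContinuouslyTV

variable {l : Filter ι} {Tn : ι → Kernel (X × U) X} [∀ n, IsMarkovKernel (Tn n)]
  {T : Kernel (X × U) X} [IsMarkovKernel T]

lemma tendsto_tvDist_nhds [l.NeBot] (h : TendstoContinuouslyTV Tn l T) (x : X) (u : U) :
    Tendsto (fun v => tvDist (T (x, v)) (T (x, u))) (𝓝 u) (𝓝 0) := by
  refine Metric.tendsto_nhds.2 fun ε hε => ?_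
  have hclose (w : U) : ∀ᶠ p : ι × U in l ×ˢ 𝓝 w, tvDist (Tn p.1 (x, p.2)) (T (x, w)) < ε / 2 :=
    (h x w).eventually (gt_mem_nhds (half_pos hε))
  obtain ⟨pn, hpn, pv, hpv, hp⟩ := eventually_prod_iff.1 (hclose u)
  filter_upwards [hpv] with v hv
  obtain ⟨n, hn, hnv⟩ := (hpn.and (hclose v).curry).exists
  have hu : tvDist (Tn n (x, v)) (T (x, u)) < ε / 2 := hp hn hv
  have hv : tvDist (Tn n (x, v)) (T (x, v)) < ε / 2 := hnv.self_of_nhds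
  rw [Real.dist_0_eq_abs, abs_of_nonneg (tvDist_nonneg _ _)]
  rw [tvDist_comm] at hv
  linarith [tvDist_triangle (T (x, v)) (Tn n (x, v)) (T (x, u))]

lemma setwiseContinuousInAction [l.NeBot] (h : TendstoContinuouslyTV Tn l T) :
    SetwiseContinuousInAction T := by
  rintro x f hf ⟨M, hM⟩
  refine continuous_iff_continuousAt.2 fun u => tendsto_iff_dist_tendsto_zero.2 ?_
  exact squeeze_zero (fun _ => dist_nonneg)
    (fun v => abs_integral_sub_le_mul_tvDist hf hM)
    (by simpa using (h.tendsto_tvDist_nhds x u).const_mul M)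

lemma tendsto_tvDist_comp [CompactSpace U] [l.NeBot] (h : TendstoContinuouslyTV Tn l T) (x : X)
    (u : ι → U) : Tendsto (fun n => tvDist (Tn n (x, u n)) (T (x, u n))) l (𝓝 0) := by
  refine tendsto_comp_of_forall_tendsto_prod_nhds
    (F := fun n v => tvDist (Tn n (x, v)) (T (x, v))) (fun w => ?_) u
  have hbound := (h x w).add ((h.tendsto_tvDist_nhds x w).comp tendsto_snd)
  rw [add_zero] at hbound
  refine squeeze_zero (fun _ => tvDist_nonneg _ _) (fun p => ?_) hbound
  rw [Function.comp_apply, tvDist_comm (T (x, p.2))]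
  exact tvDist_triangle _ _ _

lemma tendsto_integral_comp [CompactSpace U] [l.NeBot] [l.IsCountablyGenerated]
    (h : TendstoContinuouslyTV Tn l T) {f : ι → X → ℝ} (hf : ∀ n, Measurable (f n)) {M : ℝ}
    (hM : ∀ n x, |f n x| ≤ M) (hlim : ∀ x, Tendsto (fun n => f n x) l (𝓝 0)) (x : X) (u : ι → U) :
    Tendsto (fun n => ∫ y, f n y ∂T (x, u n)) l (𝓝 0) := by
  refine tendsto_comp_of_forall_tendsto_prod_nhds
    (F := fun n v => ∫ y, f n y ∂T (x, v)) (fun w => ?_) u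
  have hfix : Tendsto (fun n => ∫ y, f n y ∂T (x, w)) l (𝓝 0) := by
    simpa using tendsto_integral_filter_of_dominated_convergence (μ := T (x, w)) (fun _ => M)
      (Eventually.of_forall fun n => (hf n).aestronglyMeasurable)
      (Eventually.of_forall fun n => ae_of_all _ (hM n)) (integrable_const M) (ae_of_all _ hlim)
  have hbound := ((hfix.comp tendsto_fst).abs).add
    (((h.tendsto_tvDist_nhds x w).comp tendsto_snd).const_mul M)
  rw [abs_zero, mul_zero, add_zero] at hbound
  refine squeeze_zero_norm (fun p => ?_) hbound
  exact (norm_le_norm_add_norm_sub' _ _).trans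
    (add_le_add_right (abs_integral_sub_le_mul_tvDist (hf p.1) (hM p.1)) _)

lemma tendsto_integral_pow_sub [CompactSpace U] [l.NeBot] [l.IsCountablyGenerated]
    (h : TendstoContinuouslyTV Tn l T) (γ : ι → StationaryPolicy X U) {f : ι → X → ℝ}
    (hf : ∀ n, Measurable (f n)) {M : ℝ} (hM : ∀ n x, |f n x| ≤ M) (k : ℕ) (x : X) :
    Tendsto (fun n => ∫ y, f n y ∂((closedLoop (Tn n) (γ n) ^ k) x)
      - ∫ y, f n y ∂((closedLoop T (γ n) ^ k) x)) l (𝓝 0) := by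
  induction k generalizing x with
  | zero => simp only [integral_pow_zero _ (hf _), sub_self, tendsto_const_nhds]
  | succ k ih =>
    have hfb (n) : IsBddMeasurable (f n) := ⟨hf n, M, hM n⟩
    let p (n : ι) (z : X) : ℝ := ∫ y, f n y ∂((closedLoop (Tn n) (γ n) ^ k) z)
    let q (n : ι) (z : X) : ℝ := ∫ y, f n y ∂((closedLoop T (γ n) ^ k) z)
    have hp (n) : IsBddMeasurable (p n) := (hfb n).integral_kernel _
    have hq (n) : IsBddMeasurable (q n) := (hfb n).integral_kernel _
    have hpM (n z) : |p n z| ≤ M := abs_integral_le_of_abs_le (hM n)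
    have hqM (n z) : |q n z| ≤ M := abs_integral_le_of_abs_le (hM n)
    let u (n : ι) : U := (γ n).act x
    have hkernel : Tendsto (fun n => ∫ z, p n z ∂Tn n (x, u n) - ∫ z, p n z ∂T (x, u n)) l (𝓝 0) :=
      squeeze_zero_norm (fun n => abs_integral_sub_le_mul_tvDist (hp n).measurable (hpM n))
        (by simpa using (h.tendsto_tvDist_comp x u).const_mul M)
    have hfun : Tendsto (fun n => ∫ z, (p n z - q n z) ∂T (x, u n)) l (𝓝 0) :=
      h.tendsto_integral_comp (fun n => (hp n).measurable.sub (hq n).measurable)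
        (fun n z => (abs_sub _ _).trans (add_le_add (hpM n z) (hqM n z))) ih x u
    have hsum := hkernel.add hfun
    rw [add_zero] at hsum
    refine hsum.congr fun n => ?_
    rw [integral_sub ((hp n).integrable _) ((hq n).integrable _), sub_add_sub_cancel,
      integral_pow_add _ (hfb n), integral_pow_add _ (hfb n), pow_one, pow_one]
    rfl

lemma tendsto_avgCost_sub [CompactSpace U] [l.NeBot] [l.IsCountablyGenerated]
    (h : TendstoContinuouslyTV Tn l T) {c : X × U → ℝ} (hc : IsBddMeasurable c) {t : ℕ}
    (ht : 0 < t) {β : ℝ} (hβ : 0 ≤ β) (hβ1 : β < 1)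
    (hT : ∀ γ : StationaryPolicy X U, IsTVContraction (closedLoop T γ) t β)
    (hTn : ∀ n, ∀ γ : StationaryPolicy X U, IsTVContraction (closedLoop (Tn n) γ) t β)
    (γ : ι → StationaryPolicy X U) (x₀ : X) :
    Tendsto (fun n => avgCost c (Tn n) (γ n).toPolicy x₀ - avgCost c T (γ n).toPolicy x₀)
      l (𝓝 0) := by
  obtain ⟨M, hM⟩ := hc.exists_bound
  refine Metric.tendsto_nhds.2 fun ε hε => ?_
  obtain ⟨k, hk⟩ := ((tendsto_pow_div_mul ht hβ hβ1 (2 * M)).eventually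
    (gt_mem_nhds (show 0 < ε / 3 by positivity))).exists
  have hfix := h.tendsto_integral_pow_sub γ (f := fun n x => c (x, (γ n).act x))
    (fun n => hc.measurable.comp (measurable_id.prodMk (γ n).measurable_act)) (fun n x => hM _)
    k x₀
  filter_upwards [(Metric.tendsto_nhds.1 hfix) (ε / 3) (by positivity)] with n hn
  have hcn := abs_le.1
    (abs_integral_sub_avgCost_le hc.measurable hM (Tn n) (γ n) ht hβ hβ1 (hTn n _) x₀ k)
  have hcT := abs_le.1
    (abs_integral_sub_avgCost_le hc.measurable hM T (γ n) ht hβ hβ1 (hT _) x₀ k)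
  rw [Real.dist_0_eq_abs, abs_lt] at hn ⊢
  constructor <;> linarith [hcn.1, hcn.2, hcT.1, hcT.2, hn.1, hn.2]

end TendstoContinuouslyTV

end Convergence

end AvgCost

open AvgCost in
theorem mainTheorem4_general {ι X U : Type*} [MeasurableSpace X] [MeasurableSpace U]
    [TopologicalSpace U] [CompactSpace U] [TopologicalSpace.SeparableSpace U]
    {c : X × U → ℝ} (hc : Measurable c) (hc_bdd : ∃ M : ℝ, ∀ p, |c p| ≤ M)
    (hc_cont : ∀ x, Continuous fun u => c (x, u))
    (T : Kernel (X × U) X) [IsMarkovKernel T]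
    (Tn : ι → Kernel (X × U) X) [∀ n, IsMarkovKernel (Tn n)]
    (h_erg : UniformlyErgodic (insert T (Set.range Tn)))
    {l : Filter ι} [l.IsCountablyGenerated] (h_conv : TendstoContinuouslyTV Tn l T)
    (x₀ : X) (γ : ι → StationaryPolicy X U)
    (hγ : ∀ n, IsOptimalStationary c (Tn n) x₀ (γ n)) :
    Tendsto (fun n => |avgCost c T (γ n).toPolicy x₀ - optCost c T x₀|) l (𝓝 0) := by
  obtain rfl | hl := l.eq_or_neBot
  · exact tendsto_bot
  have hcb : IsBddMeasurable c := ⟨hc, hc_bdd⟩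
  have : Nonempty U := l.nonempty_of_neBot.map fun n => (γ n).act x₀
  obtain ⟨t, ht, β, hβ, hβ1, hcon⟩ := (h_erg.ergContraction (by
    rintro S (rfl | ⟨n, rfl⟩) <;> infer_instance)).exists_isTVContraction
  have hT := hcon T (Set.mem_insert _ _)
  have hlim := h_conv.tendsto_avgCost_sub hcb ht hβ.le hβ1 hT
    fun n => hcon (Tn n) (Set.mem_insert_of_mem _ ⟨n, rfl⟩)
  refine Metric.tendsto_nhds.2 fun ε hε => ?_
  obtain ⟨γ', hγ'⟩ := exists_avgCost_toPolicy_le_optCost_add hcb hc_cont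
    h_conv.setwiseContinuousInAction hβ1 hT x₀ (show 0 < ε / 3 by positivity)
  filter_upwards [Metric.tendsto_nhds.1 (hlim γ x₀) (ε / 3) (by positivity),
    Metric.tendsto_nhds.1 (hlim (fun _ => γ') x₀) (ε / 3) (by positivity)] with n hn hn'
  rw [Real.dist_0_eq_abs, abs_lt] at hn hn'
  have hlow := optCost_le (T := T) hcb (γ n).toPolicy x₀
  rw [Real.dist_0_eq_abs, abs_abs, abs_of_nonneg (by linarith)]
  linarith [hγ n γ', hn.1, hn'.2]

theorem mainTheorem4 {d m : ℕ}
    (X : Set (EuclideanSpace ℝ (Fin d))) (hX : MeasurableSet X)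
    (U : Set (EuclideanSpace ℝ (Fin m))) (hU : IsCompact U)
    (c : X × U → ℝ) (hc_meas : Measurable c)
    (hc_bdd : ∃ M : ℝ, ∀ p, |c p| ≤ M)
    (hc_cont : ∀ x : X, Continuous fun u : U => c (x, u))
    (T : Kernel (X × U) X) [IsMarkovKernel T]
    (Tn : ℕ → Kernel (X × U) X) [∀ n, IsMarkovKernel (Tn n)]
    (hT_cont : AvgCost.SetwiseContinuousInAction T)
    (h_erg : AvgCost.UniformlyErgodic (insert T (Set.range Tn)))
    (h_conv : ∀ (x : X) (u : U) (un : ℕ → U), Tendsto un atTop (𝓝 u) →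
      Tendsto (fun n => AvgCost.tvDist (Tn n (x, un n)) (T (x, u))) atTop (𝓝 0))
    (x₀ : X) (γ : ℕ → AvgCost.StationaryPolicy X U)
    (hγ : ∀ n, AvgCost.IsOptimalStationary c (Tn n) x₀ (γ n)) :
    Tendsto (fun n => |AvgCost.avgCost c T (γ n).toPolicy x₀ - AvgCost.optCost c T x₀|)
      atTop (𝓝 0) := by
  have : CompactSpace U := isCompact_iff_compactSpace.1 hU
  exact mainTheorem4_general hc_meas hc_bdd hc_cont T Tn h_erg
    (fun x u => AvgCost.tendsto_prod_nhds_of_forall_seq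
      (F := fun n v => AvgCost.tvDist (Tn n (x, v)) (T (x, u))) (h_conv x u)) x₀ γ hγ
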